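/- Let $G$ be a locally compact second countable (Hausdorff) group. For a group $H$ ($H=G$, or $H=\Gamma$ a countable discrete group), an \emph{$H$-space} is a standard Borel probability space $(X,\nu)$ with a measurable action of $H$ that preserves the class of $\nu$-null sets. An \emph{$H$-map} $\pi:(X,\nu)\to(Y,\eta)$ of $H$-spaces is a measurable map with $\pi_*\nu=\eta$ such that for every $h\in H$ one has $\pi(hx)=h\pi(x)$ for $\nu$-almost every $x$. Its \emph{disintegration} is the ($\eta$-almost everywhere unique) measurable map $D_\pi:Y\to P(X)$ such that $D_\pi(y)$ is carried by $\pi^{-1}(y)$ for almost every $y$ and $\int_Y D_\pi(y)\,d\eta(y)=\nu$; put $D_\pi^{(h)}(y)=h^{-1}D_\pi(hy)$. The $H$-map $\pi$ is \emph{relatively contractive} if, for every version of $D_\pi$, for $\eta$-almost every $y$ and every measurable $B\subseteq X$ with $D_\pi(y)(B)>0$, one has $\sup_{h\in H}D_\pi^{(h)}(y)(B)=1$. A \emph{lattice} $\Gamma<G$ is a discrete subgroup such that $G/\Gamma$ has a fundamental domain of finite Haar measure, where a \emph{fundamental domain} is a Borel set $F\subseteq G$ such that for every $g\in G$ there is exactly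 one $\gamma\in\Gamma$ with $g\gamma\in F$. (The Haar measure in this definition is the right Haar measure; if $\Gamma$ is a lattice then $G$ is unimodular.) Let $F$ be a fundamental domain for $G/\Gamma$ and let $m$ be the Haar measure of $G$ restricted to $F$ and normalized to a probability measure. For a $\Gamma$-space $(X,\nu)$ let $G\times_\Gamma X$ be the space of orbits $[g,x]$ of the $\Gamma$-action $\gamma\cdot(g,x)=(g\gamma^{-1},\gamma x)$ on $G\times X$, with the quotient $\sigma$-algebra, the $G$-action $h\cdot[g,x]=[hg,x]$, and the measure $\tau_*(m\times\nu)$, where $\tau:F\times X\to G\times_\Gamma X$ is the bijection $(f,x)\mapsto[f,x]$. For a $\Gamma$-map $\pi:(X,\nu)\to(Y,\eta)$ let the induced map $\Pi:G\times_\Gamma X\to G\times_\Gamma Y$ be the map $[f,x]\mapsto[f,\pi(x)]$ ($f\in F$, $x\in X$). \textbf{Theorem.} Let $\Gamma<G$ be a lattice, let $\pi:(X,\nu)\to(Y,\eta)$ be a $\Gamma$-map of $\Gamma$-spaces, and let $F$ be any fundamental domain for $G/\Gamma$. Then $G\times_\Gamma X$ and $G\times_\Gamma Y$ are $G$-spaces,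 $\Pi$ is a $G$-map, and $\pi$ is relatively contractive as a $\Gamma$-map if and only if $\Pi$ is relatively contractive as a $G$-map. -/

import Mathlib

open MeasureTheory ProbabilityTheory
open scoped ENNReal

noncomputable section

namespace RelContractive

/-! ### G-spaces, G-maps, disintegrations, relatively contractive maps -/

section Spaces

variable (G : Type*) [Group G] [MeasurableSpace G]
variable {X Y : Type*} [MeasurableSpace X] [MeasurableSpace Y] [MulAction G X] [MulAction G Y]

/-- `(X, ν)` is a `G`-space: a standard Borel probability space with a measurable action of `G`
that preserves the class of `ν`-null sets. -/
structure IsGSpace (ν : Measure X) : Prop where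
  standardBorel : StandardBorelSpace X
  isProbabilityMeasure : IsProbabilityMeasure ν
  measurable_smul : Measurable fun p : G × X => p.1 • p.2
  quasiInvariant : ∀ g : G, ν.map (fun x => g • x) ≪ ν

/-- `π : (X, ν) → (Y, η)` is a `G`-map: measurable, `π_* ν = η`, and for every `g`,
`π (g x) = g π(x)` for `ν`-almost every `x`. -/
structure IsGMap (ν : Measure X) (η : Measure Y) (π : X → Y) : Prop where
  measurable : Measurable π
  map_eq : ν.map π = η
  equivariant : ∀ g : G, ∀ᵐ x ∂ν, π (g • x) = g • π x

/-- `D : Y → P(X)` is (a version of) the disintegration of `ν` over `η` via `π`: a measurable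
family of probability measures, `D y` being carried by `π⁻¹(y)` for almost every `y`, with
`∫ D y dη(y) = ν`. -/
structure IsDisintegration (ν : Measure X) (η : Measure Y) (π : X → Y) (D : Kernel Y X) :
    Prop where
  isMarkovKernel : IsMarkovKernel D
  fiber : ∀ᵐ y ∂η, D y (π ⁻¹' {y})ᶜ = 0
  bind_eq : η.bind D = ν

variable {G}

/-- The conjugated disintegration measure `D^(g)(y) = g⁻¹ D(g y)`. -/
def conjDisintegration (D : Kernel Y X) (g : G) (y : Y) : Measure X :=
  (D (g • y)).map (fun x => g⁻¹ • x)

variable (G)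

/-- `π` is relatively contractive: for almost every `y` and every measurable `B` with
`D(y)(B) > 0`, one has `sup_g D^(g)(y)(B) = 1`.

The disintegration is only determined up to an `η`-null set, whereas the orbit of a point under an
uncountable group can meet a null set in every orbit; the condition is therefore required of
every version `D` of the disintegration. (For countable `G` all versions give the same
condition.) -/
def IsRelativelyContractive (ν : Measure X) (η : Measure Y) (π : X → Y) : Prop :=
  ∀ D : Kernel Y X, IsDisintegration ν η π D →
    ∀ᵐ y ∂η, ∀ B : Set X, MeasurableSet B → 0 < D y B →
      ⨆ g : G, conjDisintegration D g y B = 1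

end Spaces

/-! ### Fundamental domains and lattices -/

section Lattice

variable {G : Type*} [Group G] [MeasurableSpace G]

/-- `F` is a (Borel, strict) fundamental domain for `G / Γ`: for every `g` there is exactly one
`γ ∈ Γ` with `g γ ∈ F`. -/
structure IsFundDomain (Γ : Subgroup G) (F : Set G) : Prop where
  measurableSet : MeasurableSet F
  existsUnique : ∀ g : G, ∃! γ : Γ, g * (γ : G) ∈ F

/-- `Γ` is a lattice: a discrete subgroup such that `G / Γ` has a fundamental domain of finite
Haar measure. As `Γ` acts on `G` by right translations, the Haar measure to be used is the right
Haar measure (the image of the left one under inversion), for which all fundamental domains have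
the same measure; its finiteness forces `G` to be unimodular. -/
def IsLattice [TopologicalSpace G] [IsTopologicalGroup G] [LocallyCompactSpace G] [BorelSpace G]
    (Γ : Subgroup G) : Prop :=
  DiscreteTopology Γ ∧
    ∃ F : Set G, IsFundDomain Γ F ∧ (Measure.haar : Measure G).inv F < ∞

end Lattice

/-! ### Induced spaces and induced maps -/

section Induced

variable {G : Type*} [Group G]

/-- The orbit relation of the action `γ · (g, x) = (g γ⁻¹, γ x)` of `Γ` on `G × X`. -/
def inducedSetoid (Γ : Subgroup G) (X : Type*) [MulAction Γ X] : Setoid (G × X) where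
  r p q := ∃ γ : Γ, q = (p.1 * (γ : G)⁻¹, γ • p.2)
  iseqv :=
    { refl := fun p => ⟨1, by simp⟩
      symm := by
        rintro p _ ⟨γ, rfl⟩
        exact ⟨γ⁻¹, by simp⟩
      trans := by
        rintro p _ _ ⟨γ, rfl⟩ ⟨δ, rfl⟩
        exact ⟨δ * γ, by simp [mul_smul, mul_assoc]⟩ }

/-- The space `G ×_Γ X` of `Γ`-orbits in `G × X`. -/
def InducedSpace (Γ : Subgroup G) (X : Type*) [MulAction Γ X] : Type _ :=
  Quotient (inducedSetoid Γ X)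

variable {Γ : Subgroup G} {X Y : Type*} [MulAction Γ X] [MulAction Γ Y]

/-- The class `[g, x]`. -/
def InducedSpace.mk (p : G × X) : InducedSpace Γ X :=
  Quotient.mk (inducedSetoid Γ X) p

/-- The quotient `σ`-algebra of the product `σ`-algebra on `G × X`. -/
instance [MeasurableSpace G] [MeasurableSpace X] : MeasurableSpace (InducedSpace Γ X) :=
  inferInstanceAs (MeasurableSpace (Quotient (inducedSetoid Γ X)))

/-- The action `h · [g, x] = [h g, x]`. -/
instance : MulAction G (InducedSpace Γ X) where
  smul h := Quotient.map' (s₁ := inducedSetoid Γ X) (s₂ := inducedSetoid Γ X)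
    (fun p => (h * p.1, p.2)) (by
      rintro p _ ⟨γ, rfl⟩
      exact ⟨γ, by simp [mul_assoc]⟩)
  one_smul z := by
    refine Quotient.inductionOn z fun p => ?_
    exact congrArg (Quotient.mk (inducedSetoid Γ X)) (by simp)
  mul_smul a b z := by
    refine Quotient.inductionOn z fun p => ?_
    exact congrArg (Quotient.mk (inducedSetoid Γ X)) (by simp [mul_assoc])

variable [MeasurableSpace G]

/-- The element `γ ∈ Γ` with `g γ ∈ F`. -/
def IsFundDomain.toDomain {F : Set G} (hF : IsFundDomain Γ F) (g : G) : Γ :=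
  (hF.existsUnique g).choose

theorem IsFundDomain.toDomain_mem {F : Set G} (hF : IsFundDomain Γ F) (g : G) :
    g * (hF.toDomain g : G) ∈ F :=
  (hF.existsUnique g).choose_spec.1

theorem IsFundDomain.toDomain_eq {F : Set G} (hF : IsFundDomain Γ F) {g : G} {γ : Γ}
    (h : g * (γ : G) ∈ F) : hF.toDomain g = γ :=
  ((hF.existsUnique g).choose_spec.2 γ h).symm

/-- The canonical identification `ρ` of `G ×_Γ X` with `F × X`,
`[g, x] ↦ (g γ, γ⁻¹ x)` where `g γ ∈ F`; it is the inverse of `(f, x) ↦ [f, x]`. -/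
def IsFundDomain.rho {F : Set G} (hF : IsFundDomain Γ F) : InducedSpace Γ X → F × X :=
  Quotient.lift (s := inducedSetoid Γ X)
    (fun p => (⟨p.1 * (hF.toDomain p.1 : G), hF.toDomain_mem p.1⟩, (hF.toDomain p.1)⁻¹ • p.2))
    (by
      rintro p _ ⟨γ, rfl⟩
      have h : hF.toDomain (p.1 * (γ : G)⁻¹) = γ * hF.toDomain p.1 := by
        apply hF.toDomain_eq
        have := hF.toDomain_mem p.1
        simpa [mul_assoc] using this
      simp [h, mul_assoc, mul_smul])

/-- The map `τ : F × X → G ×_Γ X`, `(f, x) ↦ [f, x]`. -/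
def tau (Γ : Subgroup G) {X : Type*} [MulAction Γ X] (F : Set G) (p : F × X) :
    InducedSpace Γ X :=
  InducedSpace.mk ((p.1 : G), p.2)

theorem IsFundDomain.tau_rho {F : Set G} (hF : IsFundDomain Γ F) (z : InducedSpace Γ X) :
    tau Γ F (hF.rho z) = z := by
  refine Quotient.inductionOn z fun p => ?_
  refine Quotient.sound (s := inducedSetoid Γ X) ⟨hF.toDomain p.1, ?_⟩
  change p = (p.1 * (hF.toDomain p.1 : G) * (hF.toDomain p.1 : G)⁻¹,
    hF.toDomain p.1 • (hF.toDomain p.1)⁻¹ • p.2)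
  simp

theorem IsFundDomain.rho_tau {F : Set G} (hF : IsFundDomain Γ F) (p : F × X) :
    hF.rho (tau Γ F p) = p := by
  have h : hF.toDomain (p.1 : G) = 1 := hF.toDomain_eq (by simp)
  change (_, _) = p
  ext <;> simp [h]

/-- The induced map `Π : G ×_Γ X → G ×_Γ Y` of `π : X → Y`: the image of
`Φ = id × π : F × X → F × Y` over the identifications `G ×_Γ X ≃ F × X`, `G ×_Γ Y ≃ F × Y`. -/
def inducedMap {F : Set G} (hF : IsFundDomain Γ F) (π : X → Y) :
    InducedSpace Γ X → InducedSpace Γ Y :=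
  fun z => tau Γ F (Prod.map id π (hF.rho z))

variable [TopologicalSpace G] [IsTopologicalGroup G] [LocallyCompactSpace G] [BorelSpace G]

/-- The Haar measure of `G` restricted to `F`, normalized to be a probability measure on `F`. -/
def domainMeasure (F : Set G) : Measure F :=
  ((Measure.haar : Measure G) F)⁻¹ • (Measure.haar : Measure G).comap Subtype.val

/-- The measure `τ_* (m × ν)` on `G ×_Γ X`, with `m` the normalized Haar measure on `F`. -/
def inducedMeasure [MeasurableSpace X] (Γ : Subgroup G) [MulAction Γ X] (F : Set G)
    (ν : Measure X) : Measure (InducedSpace Γ X) :=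
  ((domainMeasure F).prod ν).map (tau Γ F)

end Induced

end RelContractive

end

set_option linter.unusedSectionVars false

/-! A fundamental domain identifies `G ×_Γ X` with `F × X`, and a set is null for the induced
measure exactly when its preimage in `G × X` is null for Haar × `ν`
(`IsFundDomain.ae_inducedMeasure_iff`). Since a lattice makes Haar measure bi-invariant, this yields
quasi-invariance under `G` and the almost everywhere equivariance of `Π`.

If `D` disintegrates `ν` over `η`, then `E[f, y] = δ_f × D(y)` disintegrates the induced measure.
Its conjugate `E^(g)[h, y]` is the image under `x ↦ [h, x]` of `D^(γ)(y)`, where `g h γ⁻¹ ∈ F`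
(`conjDisintegration_inducedKernel`). For fixed `h`, every `γ ∈ Γ` arises from some `g`, so
contractivity of `E` at `[f, y]` is that of `D` at `y`.

The remaining difficulty is that any version `D'` must be treated, while a `G`-orbit may meet the
null set where `D' ≠ E`. By Fubini, for almost every `y` the two agree at `[h, y]` for Haar-almost
every `h`. The `g` producing a given `γ` form a set of positive measure, so one of them avoids the
exceptional set. -/

namespace RelContractive

/-! ### Polish groups and standard Borel spaces. -/

section StandardBorel

theorem polishSpace_of_locallyCompact (G : Type*) [Group G] [TopologicalSpace G]
    [IsTopologicalGroup G] [LocallyCompactSpace G] [SecondCountableTopology G] [T2Space G] :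
    PolishSpace G := by
  let := IsTopologicalGroup.rightUniformSpace G
  have : IsRightUniformGroup G := { ‹IsTopologicalGroup G› with uniformity_eq := rfl }
  have : CompleteSpace G := IsRightUniformGroup.completeSpace_of_weaklyLocallyCompactSpace
  have : (uniformity G).IsCountablyGenerated := by
    rw [uniformity_eq_comap_nhds_one]
    infer_instance
  infer_instance

theorem standardBorelSpace_of_measurableEquiv {A B : Type*} [MeasurableSpace A]
    [MeasurableSpace B] [StandardBorelSpace A] (e : A ≃ᵐ B) : StandardBorelSpace B := by
  obtain ⟨τ, _, _⟩ := StandardBorelSpace.polish (α := A)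
  let t : TopologicalSpace B := .induced e.symm τ
  refine ⟨⟨t, ⟨?_⟩, e.symm.toEquiv.polishSpace_induced⟩⟩
  rw [← e.symm.measurableEmbedding.comap_eq, borel_comap]
  exact congrArg (MeasurableSpace.comap e.symm) BorelSpace.measurable_eq

end StandardBorel

/-! ### Existence and uniqueness of disintegrations. -/

section Disintegration

variable {X Y : Type*} [MeasurableSpace X] [MeasurableSpace Y]
variable {ν : Measure X} {η : Measure Y} {π : X → Y} {D : Kernel Y X}

/-- Since `D y` lives on `π⁻¹(y)`, the points `(y, x)` and `(π x, x)` coincide for `D y`-almost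
every `x`. The joint law is thus independent of `D`, which reduces uniqueness to that of conditional
kernels. -/
theorem IsDisintegration.compProd_eq [IsProbabilityMeasure η] (hD : IsDisintegration ν η π D)
    (hπ : Measurable π) : η ⊗ₘ D = ν.map fun x => (π x, x) := by
  have := hD.isMarkovKernel
  have hm : Measurable fun x => (π x, x) := hπ.prodMk measurable_id
  ext s hs
  rw [Measure.compProd_apply hs, Measure.map_apply hm hs, ← hD.bind_eq,
    Measure.bind_apply (hm hs) D.aemeasurable]
  refine lintegral_congr_ae ?_
  filter_upwards [hD.fiber] with y hy
  refine measure_congr ?_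
  have hy' : ∀ᵐ x ∂D y, π x = y := hy
  filter_upwards [hy'] with x hx
  change ((y, x) ∈ s) = ((π x, x) ∈ s)
  rw [hx]

theorem IsDisintegration.ae_eq [StandardBorelSpace X] [IsProbabilityMeasure η]
    [IsProbabilityMeasure ν] {D' : Kernel Y X} (hD : IsDisintegration ν η π D)
    (hD' : IsDisintegration ν η π D') (hπ : Measurable π) : ∀ᵐ y ∂η, D y = D' y := by
  have := hD.isMarkovKernel
  have := hD'.isMarkovKernel
  have : Nonempty X := nonempty_of_isProbabilityMeasure ν
  have h := condKernel_compProd η D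
  simp_rw [(hD.compProd_eq hπ).trans (hD'.compProd_eq hπ).symm] at h
  exact h.symm.trans (condKernel_compProd η D')

theorem exists_isDisintegration [StandardBorelSpace X] [StandardBorelSpace Y]
    [IsProbabilityMeasure ν] (hπ : Measurable π) (hη : ν.map π = η) :
    ∃ D : Kernel Y X, IsDisintegration ν η π D := by
  have : Nonempty X := nonempty_of_isProbabilityMeasure ν
  have hm : Measurable fun x => (π x, x) := hπ.prodMk measurable_id
  have : IsProbabilityMeasure (ν.map fun x => (π x, x)) :=
    Measure.isProbabilityMeasure_map hm.aemeasurable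
  have : IsProbabilityMeasure η := hη ▸ Measure.isProbabilityMeasure_map hπ.aemeasurable
  set ρ := ν.map fun x => (π x, x) with hρ
  have hfst : ρ.fst = η := by
    rw [hρ, Measure.fst, Measure.map_map measurable_fst hm]
    exact hη
  have hdis : η ⊗ₘ ρ.condKernel = ρ := by
    rw [← hfst]
    exact ρ.disintegrate ρ.condKernel
  refine ⟨ρ.condKernel, inferInstance, ?_, ?_⟩
  -- The image of `ν` under `x ↦ (π x, x)` is concentrated on the graph of `π`, so almost every
  -- conditional measure is concentrated on its fibre.
  · have hset : MeasurableSet {p : Y × X | π p.2 = p.1} :=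
      measurableSet_eq_fun (hπ.comp measurable_snd) measurable_fst
    have : ∀ᵐ p ∂(η ⊗ₘ ρ.condKernel), π p.2 = p.1 := by
      rw [hdis, hρ, ae_map_iff hm.aemeasurable hset]
      exact .of_forall fun x => rfl
    exact Measure.ae_ae_of_ae_compProd this
  · rw [← Measure.snd_compProd, hdis, hρ, Measure.snd, Measure.map_map measurable_snd hm]
    exact Measure.map_id

end Disintegration

/-! ### Unimodularity and Haar measure of fundamental domains. -/

section Haar

variable {G : Type*} [Group G] [MeasurableSpace G] {Γ : Subgroup G} {F : Set G}

/-- Inversion turns right translation by `Γ` into left translation, which preserves the left Haar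
measure; hence all the sets `F⁻¹` have equal Haar measure. -/
theorem IsFundDomain.isFundamentalDomain_inv [MeasurableInv G] (hF : IsFundDomain Γ F)
    (μ : Measure G) : IsFundamentalDomain Γ F⁻¹ μ := by
  refine IsFundamentalDomain.mk' hF.measurableSet.inv.nullMeasurableSet fun x => ?_
  obtain ⟨γ, hγ, huniq⟩ := hF.existsUnique x⁻¹
  refine ⟨γ⁻¹, ?_, fun δ hδ => ?_⟩
  · simpa [Subgroup.smul_def] using hγ
  · rw [← huniq δ⁻¹ (by simpa [Subgroup.smul_def] using hδ), inv_inv]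

theorem IsFundDomain.preimage_mul_left [MeasurableMul G] (hF : IsFundDomain Γ F) (g : G) :
    IsFundDomain Γ ((g * ·) ⁻¹' F) where
  measurableSet := measurable_const_mul g hF.measurableSet
  existsUnique h := by simpa [mul_assoc] using hF.existsUnique (g * h)

variable [TopologicalSpace G] [IsTopologicalGroup G] [LocallyCompactSpace G]
  [SecondCountableTopology G] [BorelSpace G]

/-- Right translation by `g` scales Haar measure by a constant `c`. It also carries `F⁻¹` to the
inverse of another fundamental domain, of the same measure; as this measure is finite and nonzero,
`c = 1`. -/
theorem IsLattice.isMulRightInvariant_haar [Countable Γ] (hΓ : IsLattice Γ) :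
    (Measure.haar : Measure G).IsMulRightInvariant := by
  obtain ⟨-, F, hF, hfin⟩ := hΓ
  have hfd := hF.isFundamentalDomain_inv (Measure.haar : Measure G)
  have hne : (Measure.haar : Measure G) F⁻¹ ≠ 0 := hfd.measure_ne_zero (NeZero.ne _)
  rw [Measure.inv_apply] at hfin
  refine ⟨fun g => ?_⟩
  have hc := Measure.isMulLeftInvariant_eq_smul
    ((Measure.haar : Measure G).map (· * g)) Measure.haar
  set c := Measure.haarScalarFactor ((Measure.haar : Measure G).map (· * g)) Measure.haar
  have h1 : (Measure.haar : Measure G).map (· * g) F⁻¹ = Measure.haar F⁻¹ := by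
    rw [Measure.map_apply (measurable_mul_const g) hF.measurableSet.inv]
    have := ((hF.preimage_mul_left g⁻¹).isFundamentalDomain_inv
      (Measure.haar : Measure G)).measure_eq hfd
    rw [← this]
    congr 1
    ext x
    simp
  rw [hc, Measure.smul_apply, ENNReal.smul_def, smul_eq_mul] at h1
  have hc1 : (c : ℝ≥0∞) = 1 := by
    rw [← ENNReal.mul_left_inj hne hfin.ne, h1, one_mul]
  rw [hc, ENNReal.coe_eq_one.mp hc1, one_smul]

theorem IsLattice.haar_ne_top [Countable Γ] (hΓ : IsLattice Γ) (hF : IsFundDomain Γ F) :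
    (Measure.haar : Measure G) F ≠ ∞ := by
  have := hΓ.isMulRightInvariant_haar
  obtain ⟨-, F₀, hF₀, hfin⟩ := hΓ
  have hc := Measure.isMulLeftInvariant_eq_smul (Measure.haar : Measure G).inv Measure.haar
  set c := Measure.haarScalarFactor (Measure.haar : Measure G).inv Measure.haar
  have hF' : (Measure.haar : Measure G).inv F ≠ ∞ := by
    rw [Measure.inv_apply] at hfin ⊢
    rw [(hF.isFundamentalDomain_inv (Measure.haar : Measure G)).measure_eq
      (hF₀.isFundamentalDomain_inv Measure.haar)]
    exact hfin.ne
  have hne : (c : ℝ≥0∞) ≠ 0 := by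
    intro h0
    rw [ENNReal.coe_eq_zero.mp h0, zero_smul] at hc
    exact NeZero.ne (Measure.haar : Measure G) (by
      rw [← Measure.inv_inv (Measure.haar : Measure G), hc]
      simp [Measure.inv])
  rw [hc, Measure.smul_apply, ENNReal.smul_def, smul_eq_mul] at hF'
  exact fun h => hF' (by rw [h, ENNReal.mul_top hne])

theorem IsFundDomain.haar_preimage_ne_zero [Countable Γ]
    [(Measure.haar : Measure G).IsMulRightInvariant] (hF : IsFundDomain Γ F) (g : G) :
    (Measure.haar : Measure G) ((· * g) ⁻¹' F) ≠ 0 := by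
  rw [measure_preimage_mul_right]
  intro h0
  have hcover : (Set.univ : Set G) ⊆ ⋃ γ : Γ, (· * (γ : G)) ⁻¹' F := fun x _ =>
    Set.mem_iUnion.mpr ⟨hF.toDomain x, hF.toDomain_mem x⟩
  have : (Measure.haar : Measure G) Set.univ = 0 :=
    measure_mono_null hcover (measure_iUnion_null fun γ => by
      rw [measure_preimage_mul_right, h0])
  exact NeZero.ne (Measure.haar : Measure G) (Measure.measure_univ_eq_zero.mp this)

end Haar

/-! ### Measurable structure of the induced space. -/

section InducedSpace

variable {G : Type*} [Group G] {Γ : Subgroup G} {X Y : Type*} [MulAction Γ X] [MulAction Γ Y]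
  {F : Set G}

theorem InducedSpace.smul_mk (g h : G) (x : X) :
    g • (mk (h, x) : InducedSpace Γ X) = mk (g * h, x) := rfl

theorem InducedSpace.mk_mul (h : G) (γ : Γ) (x : X) :
    (mk (h * γ, x) : InducedSpace Γ X) = mk (h, γ • x) :=
  Quotient.sound (s := inducedSetoid Γ X) ⟨γ, by simp⟩

variable [MeasurableSpace G] [MeasurableSpace X] [MeasurableSpace Y]

theorem IsFundDomain.rho_mk (hF : IsFundDomain Γ F) (h : G) (x : X) :
    hF.rho (InducedSpace.mk (h, x) : InducedSpace Γ X) =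
      (⟨h * (hF.toDomain h : G), hF.toDomain_mem h⟩, (hF.toDomain h)⁻¹ • x) := rfl

theorem inducedMap_mk (hF : IsFundDomain Γ F) (π : X → Y) (h : G) (x : X) :
    inducedMap hF π (InducedSpace.mk (h, x)) =
      InducedSpace.mk (h, hF.toDomain h • π ((hF.toDomain h)⁻¹ • x)) :=
  InducedSpace.mk_mul h (hF.toDomain h) _

theorem InducedSpace.measurable_mk :
    Measurable (InducedSpace.mk : G × X → InducedSpace Γ X) :=
  measurable_quotient_mk' (s := inducedSetoid Γ X)

theorem measurable_tau : Measurable (tau Γ F : F × X → InducedSpace Γ X) :=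
  InducedSpace.measurable_mk.comp
    ((measurable_subtype_coe.comp measurable_fst).prodMk measurable_snd)

section

variable [MeasurableSingletonClass G] [MeasurableMul₂ G] [MeasurableInv G] [Countable Γ]

theorem IsFundDomain.measurable_toDomain (hF : IsFundDomain Γ F) :
    Measurable hF.toDomain := by
  refine measurable_to_countable' fun γ => ?_
  have : hF.toDomain ⁻¹' {γ} = (· * (γ : G)) ⁻¹' F := by
    ext g
    refine ⟨fun h => ?_, fun h => hF.toDomain_eq h⟩
    have h' : hF.toDomain g = γ := h
    rw [← h']
    exact hF.toDomain_mem g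
  rw [this]
  exact measurable_mul_const _ hF.measurableSet

theorem IsFundDomain.measurable_rho (hF : IsFundDomain Γ F)
    (hX : Measurable fun p : Γ × X => p.1 • p.2) :
    Measurable (hF.rho : InducedSpace Γ X → F × X) := by
  refine measurable_from_quotient.mpr ?_
  have hd : Measurable fun p : G × X => hF.toDomain p.1 :=
    hF.measurable_toDomain.comp measurable_fst
  refine Measurable.prodMk (Measurable.subtype_mk ?_) (hX.comp
    (g := fun p : Γ × X => p.1 • p.2) (f := fun p : G × X => ((hF.toDomain p.1)⁻¹, p.2)) ?_)
  · exact measurable_fst.mul (measurable_subtype_coe.comp hd)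
  · exact ((measurable_of_countable _).comp hd).prodMk measurable_snd

theorem IsFundDomain.measurable_inducedMap (hF : IsFundDomain Γ F)
    (hX : Measurable fun p : Γ × X => p.1 • p.2) {π : X → Y} (hπ : Measurable π) :
    Measurable (inducedMap hF π) :=
  measurable_tau.comp ((measurable_id.prodMap hπ).comp (hF.measurable_rho hX))

/-- The identification of `F × X` with `G ×_Γ X` as a measurable equivalence. -/
noncomputable def IsFundDomain.measurableEquiv (hF : IsFundDomain Γ F)
    (hX : Measurable fun p : Γ × X => p.1 • p.2) : F × X ≃ᵐ InducedSpace Γ X where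
  toFun := tau Γ F
  invFun := hF.rho
  left_inv := hF.rho_tau
  right_inv := hF.tau_rho
  measurable_toFun := measurable_tau
  measurable_invFun := hF.measurable_rho hX

theorem IsFundDomain.measurable_smul_inducedSpace (hF : IsFundDomain Γ F)
    (hX : Measurable fun p : Γ × X => p.1 • p.2) :
    Measurable fun p : G × InducedSpace Γ X => p.1 • p.2 := by
  have hr := (hF.measurable_rho hX).comp (measurable_snd : Measurable (Prod.snd : G × _ → _))
  have : (fun p : G × InducedSpace Γ X => p.1 • p.2) =
      fun p => InducedSpace.mk (p.1 * ((hF.rho p.2).1 : G), (hF.rho p.2).2) := by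
    funext p
    conv_lhs => rw [← hF.tau_rho p.2]
    rfl
  rw [this]
  exact InducedSpace.measurable_mk.comp ((measurable_fst.mul
    (measurable_subtype_coe.comp (measurable_fst.comp hr))).prodMk (measurable_snd.comp hr))

theorem IsGSpace.measurable_const_smul {ν : Measure X} (hX : IsGSpace Γ ν) (γ : Γ) :
    Measurable fun x : X => γ • x :=
  hX.measurable_smul.comp measurable_prodMk_left

theorem IsGSpace.ae_smul {ν : Measure X} (hX : IsGSpace Γ ν) {p : X → Prop}
    (hp : ∀ᵐ x ∂ν, p x) (γ : Γ) : ∀ᵐ x ∂ν, p (γ • x) :=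
  ae_of_ae_map (hX.measurable_const_smul γ).aemeasurable ((hX.quasiInvariant γ).ae_le hp)

end

end InducedSpace

/-! ### Null sets of the induced measure; induced spaces and maps. -/

section InducedMeasure

variable {G : Type*} [Group G] [TopologicalSpace G] [IsTopologicalGroup G]
  [LocallyCompactSpace G] [SecondCountableTopology G] [T2Space G]
  [MeasurableSpace G] [BorelSpace G] {Γ : Subgroup G} {F : Set G}
  {X Y : Type*} [MeasurableSpace X] [MeasurableSpace Y] [MulAction Γ X] [MulAction Γ Y]
  {ν : Measure X} {η : Measure Y} {π : X → Y}

theorem isProbabilityMeasure_domainMeasure (hF : MeasurableSet F)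
    (h0 : (Measure.haar : Measure G) F ≠ 0) (htop : (Measure.haar : Measure G) F ≠ ∞) :
    IsProbabilityMeasure (domainMeasure F) := by
  refine ⟨?_⟩
  rw [domainMeasure, Measure.smul_apply, comap_subtype_coe_apply hF, smul_eq_mul]
  simpa using ENNReal.inv_mul_cancel h0 htop

theorem ae_domainMeasure_iff (hF : MeasurableSet F) (htop : (Measure.haar : Measure G) F ≠ ∞)
    {p : G → Prop} :
    (∀ᵐ f : F ∂domainMeasure F, p f) ↔ ∀ᵐ h ∂(Measure.haar : Measure G), h ∈ F → p h := by
  rw [domainMeasure, Measure.ae_ennreal_smul_measure_iff (ENNReal.inv_ne_zero.mpr htop),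
    ← ae_restrict_iff_subtype hF, ae_restrict_iff' hF]

theorem IsGSpace.standardBorelSpace_inducedSpace [Countable Γ] (hX : IsGSpace Γ ν)
    (hF : IsFundDomain Γ F) : StandardBorelSpace (InducedSpace Γ X) := by
  have := hX.standardBorel
  have := polishSpace_of_locallyCompact G
  have := hF.measurableSet.standardBorel
  exact standardBorelSpace_of_measurableEquiv (hF.measurableEquiv hX.measurable_smul)

theorem IsFundDomain.ae_inducedMeasure_iff_prod [Countable Γ] (hF : IsFundDomain Γ F)
    (hX : IsGSpace Γ ν) {p : InducedSpace Γ X → Prop} :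
    (∀ᵐ z ∂inducedMeasure Γ F ν, p z) ↔ ∀ᵐ q ∂(domainMeasure F).prod ν, p (tau Γ F q) :=
  (hF.measurableEquiv hX.measurable_smul).measurableEmbedding.ae_map_iff

theorem isProbabilityMeasure_inducedMeasure [IsProbabilityMeasure (domainMeasure F)]
    [IsProbabilityMeasure ν] : IsProbabilityMeasure (inducedMeasure Γ F ν) :=
  Measure.isProbabilityMeasure_map measurable_tau.aemeasurable

/-- Null sets of the induced measure are those whose preimage in `G × X` is null. -/
theorem IsFundDomain.ae_inducedMeasure_iff [Countable Γ]
    [(Measure.haar : Measure G).IsMulRightInvariant] (hF : IsFundDomain Γ F)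
    (htop : (Measure.haar : Measure G) F ≠ ∞) (hX : IsGSpace Γ ν)
    {S : Set (InducedSpace Γ X)} (hS : MeasurableSet S) :
    (∀ᵐ z ∂inducedMeasure Γ F ν, z ∈ S) ↔
      ∀ᵐ h ∂(Measure.haar : Measure G), ∀ᵐ x ∂ν, InducedSpace.mk (h, x) ∈ S := by
  have := hX.isProbabilityMeasure
  rw [hF.ae_inducedMeasure_iff_prod hX, Measure.ae_prod_iff_ae_ae (measurable_tau hS)]
  change (∀ᵐ f : F ∂domainMeasure F, ∀ᵐ x ∂ν, InducedSpace.mk ((f : G), x) ∈ S) ↔ _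
  rw [ae_domainMeasure_iff hF.measurableSet htop
    (p := fun h => ∀ᵐ x ∂ν, InducedSpace.mk (h, x) ∈ S)]
  refine ⟨fun h => ?_, fun h => h.mono fun _ hx _ => hx⟩
  -- The countably many translates of `F` cover `G`, and right translation preserves Haar-null sets.
  -- The identity `[h γ, x] = [h, γ x]` and quasi-invariance of `ν` then carry the statement from
  -- `F` to all of `G`.
  have hall : ∀ᵐ h ∂(Measure.haar : Measure G), ∀ γ : Γ, h * (γ : G) ∈ F →
      ∀ᵐ x ∂ν, (InducedSpace.mk (h * (γ : G), x) : InducedSpace Γ X) ∈ S := by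
    refine ae_all_iff.mpr fun γ => ?_
    exact (measurePreserving_mul_right Measure.haar (γ : G)).quasiMeasurePreserving.ae
      (p := fun h => h ∈ F → ∀ᵐ x ∂ν, (InducedSpace.mk (h, x) : InducedSpace Γ X) ∈ S) h
  filter_upwards [hall] with h hh
  filter_upwards [hX.ae_smul (hh _ (hF.toDomain_mem h)) (hF.toDomain h)⁻¹] with x hx
  simpa [InducedSpace.mk_mul] using hx

theorem IsFundDomain.ae_ae_mk_of_ae_inducedMeasure [Countable Γ]
    [(Measure.haar : Measure G).IsMulRightInvariant] (hF : IsFundDomain Γ F)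
    (htop : (Measure.haar : Measure G) F ≠ ∞) (hX : IsGSpace Γ ν)
    {p : InducedSpace Γ X → Prop} (hp : ∀ᵐ z ∂inducedMeasure Γ F ν, p z) :
    ∀ᵐ x ∂ν, ∀ᵐ h ∂(Measure.haar : Measure G), p (InducedSpace.mk (h, x)) := by
  have := hX.isProbabilityMeasure
  obtain ⟨S, hpS, hS, h0⟩ := exists_measurable_superset_of_null (ae_iff.mp hp)
  have h1 := (hF.ae_inducedMeasure_iff htop hX hS.compl).mp (measure_eq_zero_iff_ae_notMem.mp h0)
  rw [Measure.ae_ae_comm (p := fun h x => (InducedSpace.mk (h, x) : InducedSpace Γ X) ∈ Sᶜ)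
    (InducedSpace.measurable_mk hS.compl)] at h1
  filter_upwards [h1] with x hx
  filter_upwards [hx] with h hh
  exact not_not.mp fun hn => hh (hpS hn)

variable [Countable Γ] [(Measure.haar : Measure G).IsMulRightInvariant]
  [IsProbabilityMeasure (domainMeasure F)]

theorem IsGSpace.induced (hX : IsGSpace Γ ν) (hF : IsFundDomain Γ F)
    (htop : (Measure.haar : Measure G) F ≠ ∞) :
    IsGSpace G (inducedMeasure Γ F ν) where
  standardBorel := hX.standardBorelSpace_inducedSpace hF
  isProbabilityMeasure := by
    have := hX.isProbabilityMeasure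
    exact isProbabilityMeasure_inducedMeasure
  measurable_smul := hF.measurable_smul_inducedSpace hX.measurable_smul
  quasiInvariant g := by
    have hg : Measurable fun z : InducedSpace Γ X => g • z :=
      (hF.measurable_smul_inducedSpace hX.measurable_smul).comp measurable_prodMk_left
    refine Measure.AbsolutelyContinuous.mk fun S hS h0 => ?_
    rw [Measure.map_apply hg hS]
    have h1 : ∀ᵐ z ∂(inducedMeasure Γ F ν), z ∈ Sᶜ := measure_eq_zero_iff_ae_notMem.mp h0
    rw [hF.ae_inducedMeasure_iff htop hX hS.compl] at h1
    refine measure_eq_zero_iff_ae_notMem.mpr ?_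
    change ∀ᵐ z ∂(inducedMeasure Γ F ν), z ∈ ((fun z => g • z) ⁻¹' S)ᶜ
    rw [hF.ae_inducedMeasure_iff htop hX (hg hS).compl]
    exact (measurePreserving_mul_left Measure.haar g).quasiMeasurePreserving.ae
      (p := fun h => ∀ᵐ x ∂ν, (InducedSpace.mk (h, x) : InducedSpace Γ X) ∈ Sᶜ) h1

theorem IsGMap.ae_forall (hX : IsGSpace Γ ν) (hπ : IsGMap Γ ν η π) :
    ∀ᵐ x ∂ν, ∀ γ δ : Γ, π (γ • δ • x) = γ • π (δ • x) :=
  ae_all_iff.mpr fun γ => ae_all_iff.mpr fun δ => hX.ae_smul (hπ.equivariant γ) δ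

/-- As `Γ` is countable, one null set of `x` serves all its elements, hence all `h` at once. Off
that set `Π` no longer depends on `F`. -/
theorem IsGMap.ae_inducedMap_mk (hX : IsGSpace Γ ν) (hπ : IsGMap Γ ν η π)
    (hF : IsFundDomain Γ F) :
    ∀ᵐ x ∂ν, ∀ h, inducedMap hF π (InducedSpace.mk (h, x)) = InducedSpace.mk (h, π x) := by
  filter_upwards [hπ.ae_forall hX] with x hx h
  rw [inducedMap_mk, ← hx, smul_inv_smul]

theorem IsGMap.induced (hX : IsGSpace Γ ν) (hY : IsGSpace Γ η) (hπ : IsGMap Γ ν η π)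
    (hF : IsFundDomain Γ F) (htop : (Measure.haar : Measure G) F ≠ ∞) :
    IsGMap G (inducedMeasure Γ F ν) (inducedMeasure Γ F η) (inducedMap hF π) where
  measurable := hF.measurable_inducedMap hX.measurable_smul hπ.measurable
  map_eq := by
    have := hX.isProbabilityMeasure
    have := hY.isProbabilityMeasure
    have hm := hF.measurable_inducedMap hX.measurable_smul hπ.measurable
    have : inducedMap hF π ∘ tau Γ F = tau Γ F ∘ Prod.map id π := by
      funext p
      simp [inducedMap, hF.rho_tau]
    rw [inducedMeasure, inducedMeasure, Measure.map_map hm measurable_tau, this,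
      ← Measure.map_map measurable_tau (measurable_id.prodMap hπ.measurable),
      ← Measure.map_prod_map _ _ measurable_id hπ.measurable, Measure.map_id, hπ.map_eq]
  equivariant g := by
    have := (hX.induced hF htop).standardBorel
    have := (hY.induced hF htop).standardBorel
    have hm := hF.measurable_inducedMap hX.measurable_smul hπ.measurable
    have hgX : Measurable fun z : InducedSpace Γ X => g • z :=
      (hF.measurable_smul_inducedSpace hX.measurable_smul).comp measurable_prodMk_left
    have hgY : Measurable fun z : InducedSpace Γ Y => g • z :=
      (hF.measurable_smul_inducedSpace hY.measurable_smul).comp measurable_prodMk_left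
    refine (hF.ae_inducedMeasure_iff htop hX
      (measurableSet_eq_fun (hm.comp hgX) (hgY.comp hm))).mpr (.of_forall fun h => ?_)
    filter_upwards [hπ.ae_inducedMap_mk hX hF] with x hx
    change inducedMap hF π (InducedSpace.mk (g * h, x)) =
      g • inducedMap hF π (InducedSpace.mk (h, x))
    rw [hx, hx, InducedSpace.smul_mk]

end InducedMeasure

/-! ### The induced disintegration and its conjugates. -/

section InducedKernel

variable {G : Type*} [Group G] [TopologicalSpace G] [IsTopologicalGroup G]
  [LocallyCompactSpace G] [SecondCountableTopology G] [T2Space G]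
  [MeasurableSpace G] [BorelSpace G] {Γ : Subgroup G} [Countable Γ] {F : Set G}
  {X Y : Type*} [MeasurableSpace X] [MeasurableSpace Y] [MulAction Γ X] [MulAction Γ Y]
  {ν : Measure X} {η : Measure Y} {π : X → Y}

/-- The kernel from `G ×_Γ Y` to `G ×_Γ X` that corresponds to `(f, y) ↦ δ_f × D y` under the
identifications with `F × Y` and `F × X`. -/
noncomputable def inducedKernel (hF : IsFundDomain Γ F) (hY : IsGSpace Γ η) (D : Kernel Y X) :
    Kernel (InducedSpace Γ Y) (InducedSpace Γ X) :=
  ((Kernel.id ∥ₖ D).map (tau Γ F)).comap hF.rho (hF.measurable_rho hY.measurable_smul)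

instance (hF : IsFundDomain Γ F) (hY : IsGSpace Γ η) (D : Kernel Y X) [IsMarkovKernel D] :
    IsMarkovKernel (inducedKernel hF hY D) := by
  have : IsMarkovKernel ((Kernel.id ∥ₖ D).map (tau Γ F : F × X → InducedSpace Γ X)) :=
    Kernel.IsMarkovKernel.map _ measurable_tau
  unfold inducedKernel
  infer_instance

theorem InducedSpace.measurable_mk_right (h : G) :
    Measurable fun x : X => (mk (h, x) : InducedSpace Γ X) :=
  measurable_mk.comp measurable_prodMk_left

theorem inducedKernel_apply (hF : IsFundDomain Γ F) (hY : IsGSpace Γ η) (D : Kernel Y X)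
    [IsMarkovKernel D] (z : InducedSpace Γ Y) :
    inducedKernel hF hY D z =
      (D (hF.rho z).2).map fun x => InducedSpace.mk (((hF.rho z).1 : G), x) := by
  rw [inducedKernel, Kernel.comap_apply, Kernel.map_apply _ measurable_tau,
    Kernel.parallelComp_apply, Kernel.id_apply, Measure.dirac_prod,
    Measure.map_map measurable_tau measurable_prodMk_left]
  rfl

theorem inducedKernel_mk (hX : IsGSpace Γ ν) (hF : IsFundDomain Γ F) (hY : IsGSpace Γ η)
    (D : Kernel Y X) [IsMarkovKernel D] (h : G) (y : Y) :
    inducedKernel hF hY D (InducedSpace.mk (h, y)) =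
      (conjDisintegration D (hF.toDomain h)⁻¹ y).map fun x => InducedSpace.mk (h, x) := by
  rw [inducedKernel_apply, conjDisintegration, Measure.map_map
    (InducedSpace.measurable_mk_right h) (hX.measurable_const_smul _), hF.rho_mk, inv_inv]
  congr 1
  funext x
  exact InducedSpace.mk_mul h _ x

/-- Returning `g h` to `F` costs an element of `Γ`, which conjugates `D`; the translation by `g⁻¹`
then undoes `g` in the first coordinate. The equality holds at every point, not just almost
everywhere. -/
theorem conjDisintegration_inducedKernel (hX : IsGSpace Γ ν) (hF : IsFundDomain Γ F)
    (hY : IsGSpace Γ η) (D : Kernel Y X) [IsMarkovKernel D] (g h : G) (y : Y) :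
    conjDisintegration (inducedKernel hF hY D) g (InducedSpace.mk (h, y)) =
      (conjDisintegration D (hF.toDomain (g * h))⁻¹ y).map fun x => InducedSpace.mk (h, x) := by
  have hm : Measurable fun z : InducedSpace Γ X => g⁻¹ • z :=
    (hF.measurable_smul_inducedSpace hX.measurable_smul).comp measurable_prodMk_left
  rw [conjDisintegration, InducedSpace.smul_mk, inducedKernel_mk hX,
    Measure.map_map hm (InducedSpace.measurable_mk_right _)]
  congr 1
  funext x
  simp [InducedSpace.smul_mk]

theorem IsFundDomain.toDomain_of_mem (hF : IsFundDomain Γ F) {f : G} (hf : f ∈ F) :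
    hF.toDomain f = 1 :=
  hF.toDomain_eq (by simpa using hf)

theorem inducedKernel_mk_of_mem (hF : IsFundDomain Γ F) (hY : IsGSpace Γ η) (D : Kernel Y X)
    [IsMarkovKernel D] {f : G} (hf : f ∈ F) (y : Y) :
    inducedKernel hF hY D (InducedSpace.mk (f, y)) =
      (D y).map fun x => InducedSpace.mk (f, x) := by
  have hr : hF.rho (InducedSpace.mk (f, y) : InducedSpace Γ Y) = (⟨f, hf⟩, y) :=
    hF.rho_tau (⟨f, hf⟩, y)
  rw [inducedKernel_apply, hr]

theorem IsDisintegration.induced [IsProbabilityMeasure (domainMeasure F)]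
    (hX : IsGSpace Γ ν) (hF : IsFundDomain Γ F) (hY : IsGSpace Γ η) {D : Kernel Y X}
    (hD : IsDisintegration ν η π D) (hπ : Measurable π) :
    IsDisintegration (inducedMeasure Γ F ν) (inducedMeasure Γ F η) (inducedMap hF π)
      (inducedKernel hF hY D) where
  isMarkovKernel := by
    have := hD.isMarkovKernel
    infer_instance
  fiber := by
    have := hD.isMarkovKernel
    have := hX.isProbabilityMeasure
    have := hY.isProbabilityMeasure
    have := hY.standardBorelSpace_inducedSpace hF
    have hm := hF.measurable_inducedMap hX.measurable_smul hπ
    rw [hF.ae_inducedMeasure_iff_prod hY]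
    filter_upwards [Measure.quasiMeasurePreserving_snd.ae hD.fiber] with p hp
    rw [inducedKernel_apply, hF.rho_tau, Measure.map_apply (InducedSpace.measurable_mk_right _)
      (hm (measurableSet_singleton _)).compl]
    refine measure_mono_null (Set.compl_subset_compl.mpr fun x (hx : π x = p.2) => ?_) hp
    change inducedMap hF π (InducedSpace.mk ((p.1 : G), x)) = InducedSpace.mk ((p.1 : G), p.2)
    -- At a representative in `F` the correcting element is `1`, so equivariance of `π` is not
    -- needed.
    rw [inducedMap_mk, hF.toDomain_of_mem p.1.2, inv_one, one_smul, one_smul, hx]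
  bind_eq := by
    have := hD.isMarkovKernel
    have := hX.isProbabilityMeasure
    have := hY.isProbabilityMeasure
    ext S hS
    have hS' := measurable_tau (Γ := Γ) (F := F) (X := X) hS
    have hK := (inducedKernel hF hY D).measurable_coe hS
    rw [Measure.bind_apply hS (Kernel.aemeasurable _), inducedMeasure, inducedMeasure,
      lintegral_map hK measurable_tau, Measure.map_apply measurable_tau hS,
      lintegral_prod
      (fun p => inducedKernel hF hY D (tau Γ F p) S) (hK.comp measurable_tau).aemeasurable, Measure.prod_apply hS']
    refine lintegral_congr fun f => ?_
    have hf : MeasurableSet (Prod.mk f ⁻¹' (tau Γ F ⁻¹' S) : Set X) := measurable_prodMk_left hS'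
    rw [← hD.bind_eq, Measure.bind_apply hf D.aemeasurable]
    refine lintegral_congr fun y => ?_
    rw [inducedKernel_apply, hF.rho_tau, Measure.map_apply
      (InducedSpace.measurable_mk_right _) hS]
    rfl

theorem iSup_conjDisintegration_inducedKernel (hX : IsGSpace Γ ν) (hF : IsFundDomain Γ F)
    (hY : IsGSpace Γ η) (D : Kernel Y X) [IsMarkovKernel D] (f : F) (y : Y)
    {B : Set (InducedSpace Γ X)} (hB : MeasurableSet B) :
    ⨆ g : G, conjDisintegration (inducedKernel hF hY D) g (InducedSpace.mk ((f : G), y)) B =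
      ⨆ γ : Γ, conjDisintegration D γ y {x | InducedSpace.mk ((f : G), x) ∈ B} := by
  -- With `g = f γ f⁻¹` one has `g f = f γ`, which `γ⁻¹` returns to `f ∈ F`.
  have hsurj : Function.Surjective fun g : G => (hF.toDomain (g * f))⁻¹ := fun γ =>
    ⟨f * γ * (f : G)⁻¹, inv_eq_iff_eq_inv.mpr (hF.toDomain_eq (by simp))⟩
  rw [← hsurj.iSup_comp]
  refine iSup_congr fun g => ?_
  rw [conjDisintegration_inducedKernel hX,
    Measure.map_apply (InducedSpace.measurable_mk_right _) hB]
  rfl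

end InducedKernel

/-! ### Transfer of relative contractivity in both directions. -/

section RelativelyContractive

variable {G : Type*} [Group G] [TopologicalSpace G] [IsTopologicalGroup G]
  [LocallyCompactSpace G] [SecondCountableTopology G] [T2Space G]
  [MeasurableSpace G] [BorelSpace G] {Γ : Subgroup G} [Countable Γ] {F : Set G}
  {X Y : Type*} [MeasurableSpace X] [MeasurableSpace Y] [MulAction Γ X] [MulAction Γ Y]
  {ν : Measure X} {η : Measure Y} {π : X → Y} [IsProbabilityMeasure (domainMeasure F)]

theorem IsRelativelyContractive.of_induced (hX : IsGSpace Γ ν) (hY : IsGSpace Γ η)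
    (hπ : Measurable π) (hF : IsFundDomain Γ F)
    (h : IsRelativelyContractive G (inducedMeasure Γ F ν) (inducedMeasure Γ F η)
      (inducedMap hF π)) : IsRelativelyContractive Γ ν η π := by
  intro D hD
  have := hD.isMarkovKernel
  have := hX.isProbabilityMeasure
  have := hY.isProbabilityMeasure
  have h1 := h _ (hD.induced hX hF hY hπ)
  rw [hF.ae_inducedMeasure_iff_prod hY] at h1
  -- A single good `f` suffices: the conclusion concerns `y` only, and the slice over `f` of the set
  -- corresponding to `F × B` is `B`.
  obtain ⟨f, hf⟩ := (Measure.ae_ae_of_ae_prod h1).exists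
  filter_upwards [hf] with y hy B hB hpos
  set B' : Set (InducedSpace Γ X) := {z | (hF.rho z).2 ∈ B}
  have hB' : MeasurableSet B' :=
    (measurable_snd.comp (hF.measurable_rho hX.measurable_smul)) hB
  have hBB' : {x : X | (InducedSpace.mk ((f : G), x) : InducedSpace Γ X) ∈ B'} = B := by
    ext x
    change (hF.rho (tau Γ F (f, x))).2 ∈ B ↔ _
    rw [hF.rho_tau]
  have h2 := hy B' hB' (by
    change 0 < inducedKernel hF hY D (InducedSpace.mk ((f : G), y)) B'
    rw [inducedKernel_mk_of_mem hF hY D f.2,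
      Measure.map_apply (InducedSpace.measurable_mk_right _) hB']
    change 0 < D y {x : X | (InducedSpace.mk ((f : G), x) : InducedSpace Γ X) ∈ B'}
    rwa [hBB'])
  have h3 := iSup_conjDisintegration_inducedKernel hX hF hY D f y hB'
  rw [hBB'] at h3
  exact h3.symm.trans h2

theorem conjDisintegration_le_one {H : Type*} [Group H] [MulAction H X] [MulAction H Y]
    (D : Kernel Y X) [IsMarkovKernel D] {g : H} (hg : Measurable fun x : X => g⁻¹ • x) (y : Y)
    (B : Set X) : conjDisintegration D g y B ≤ 1 :=
  have : IsProbabilityMeasure (conjDisintegration D g y) :=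
    Measure.isProbabilityMeasure_map hg.aemeasurable
  prob_le_one

theorem IsRelativelyContractive.induced [(Measure.haar : Measure G).IsMulRightInvariant]
    (hX : IsGSpace Γ ν) (hY : IsGSpace Γ η) (hπ : IsGMap Γ ν η π) (hF : IsFundDomain Γ F)
    (htop : (Measure.haar : Measure G) F ≠ ∞) (h : IsRelativelyContractive Γ ν η π) :
    IsRelativelyContractive G (inducedMeasure Γ F ν) (inducedMeasure Γ F η)
      (inducedMap hF π) := by
  intro D' hD'
  have := hX.standardBorel
  have := hY.standardBorel
  have := hX.isProbabilityMeasure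
  have := hY.isProbabilityMeasure
  have hX' := hX.induced hF htop
  have := hX'.standardBorel
  have := hX'.isProbabilityMeasure
  have := (hY.induced hF htop).isProbabilityMeasure
  have := hD'.isMarkovKernel
  obtain ⟨D, hD⟩ := exists_isDisintegration hπ.measurable hπ.map_eq
  have := hD.isMarkovKernel
  have heq := hD'.ae_eq (hD.induced hX hF hY hπ.measurable)
    (hF.measurable_inducedMap hX.measurable_smul hπ.measurable)
  -- The orbit of `[f, y]` is the set of all `[h, y]`; for almost every `y` the two kernels agree at
  -- Haar-almost all of these `h`.
  have hae := hF.ae_ae_mk_of_ae_inducedMeasure htop hY heq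
  rw [hF.ae_inducedMeasure_iff_prod hY] at heq ⊢
  filter_upwards [heq, Measure.quasiMeasurePreserving_snd.ae hae,
    Measure.quasiMeasurePreserving_snd.ae (h D hD)] with ⟨f, y⟩ hz hy hc B hB hpos
  change D' (InducedSpace.mk ((f : G), y)) = inducedKernel hF hY D (InducedSpace.mk ((f : G), y))
    at hz
  change 0 < D' (InducedSpace.mk ((f : G), y)) B at hpos
  rw [hz, inducedKernel_mk_of_mem hF hY D f.2,
    Measure.map_apply (InducedSpace.measurable_mk_right _) hB] at hpos
  refine le_antisymm (iSup_le fun g => conjDisintegration_le_one D'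
    (hX'.measurable_smul.comp measurable_prodMk_left) _ _) ?_
  rw [← hc _ (InducedSpace.measurable_mk_right _ hB) hpos]
  refine iSup_le fun γ => ?_
  -- The set of `a` with `a γ⁻¹ ∈ F` has positive Haar measure, so it contains an `a` at which the
  -- kernels agree. Then `g = a f⁻¹` moves `[f, y]` to `[a, y]` and realizes `γ`.
  obtain ⟨a, haF, ha⟩ := ((frequently_ae_mem_iff.mpr
    (hF.haar_preimage_ne_zero ((γ⁻¹ : Γ) : G))).and_eventually hy).exists
  refine le_iSup_of_le (a * (f : G)⁻¹) (le_of_eq ?_)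
  have hmk : (a * (f : G)⁻¹) • (tau Γ F (f, y) : InducedSpace Γ Y) = InducedSpace.mk (a, y) := by
    change (InducedSpace.mk (a * (f : G)⁻¹ * f, y) : InducedSpace Γ Y) = _
    rw [inv_mul_cancel_right]
  have hγ : (hF.toDomain (a * (f : G)⁻¹ * f))⁻¹ = γ := by
    rw [inv_mul_cancel_right, hF.toDomain_eq haF, inv_inv]
  have h1 : conjDisintegration D' (a * (f : G)⁻¹) (tau Γ F (f, y)) =
      conjDisintegration (inducedKernel hF hY D) (a * (f : G)⁻¹)
        (InducedSpace.mk ((f : G), y)) := by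
    change Measure.map _ (D' _) = Measure.map _ (inducedKernel hF hY D _)
    rw [hmk, ha]
    exact congrArg (fun z => Measure.map _ (inducedKernel hF hY D z)) hmk.symm
  rw [h1, conjDisintegration_inducedKernel hX, hγ,
    Measure.map_apply (InducedSpace.measurable_mk_right _) hB]

end RelativelyContractive

end RelContractive

open RelContractive in
theorem mainTheorem8
    {G : Type*} [Group G] [TopologicalSpace G] [IsTopologicalGroup G]
    [LocallyCompactSpace G] [SecondCountableTopology G] [T2Space G]
    [MeasurableSpace G] [BorelSpace G]
    (Γ : Subgroup G) (hΓ : IsLattice Γ)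
    {X Y : Type*} [MeasurableSpace X] [MeasurableSpace Y] [MulAction Γ X] [MulAction Γ Y]
    (ν : Measure X) (η : Measure Y) (hX : IsGSpace Γ ν) (hY : IsGSpace Γ η)
    (π : X → Y) (hπ : IsGMap Γ ν η π)
    (F : Set G) (hF : IsFundDomain Γ F) :
    (IsGSpace G (inducedMeasure Γ F ν) ∧ IsGSpace G (inducedMeasure Γ F η) ∧
      IsGMap G (inducedMeasure Γ F ν) (inducedMeasure Γ F η) (inducedMap hF π)) ∧
    (IsRelativelyContractive Γ ν η π ↔
      IsRelativelyContractive G (inducedMeasure Γ F ν) (inducedMeasure Γ F η)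
        (inducedMap hF π)) := by
  have := hΓ.1
  have : Countable Γ := countable_of_Lindelof_of_discrete
  have := hΓ.isMulRightInvariant_haar
  have htop := hΓ.haar_ne_top hF
  have hne : (Measure.haar : Measure G) F ≠ 0 := by simpa using hF.haar_preimage_ne_zero 1
  have := isProbabilityMeasure_domainMeasure hF.measurableSet hne htop
  exact ⟨⟨hX.induced hF htop, hY.induced hF htop, hπ.induced hX hY hF htop⟩,
    fun h => h.induced hX hY hπ hF htop, fun h => h.of_induced hX hY hπ.measurable hF⟩
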